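/- For a sequence $\mathbf a=(a_i)_{i\ge 0}$ of non-negative integers consider the conditions: (A1) $\mathbf a$ is bounded; (A2) $a_0\ne 0$; (A3) there is an integer $C>0$ such that $a_i=a_{i+1}=\dots=a_{i+k}=0$ implies $k<C$. If $0\le a_i\le N$ for all $i$, let $\{*,0,1,\dots,N\}^{\mathbb Z}$ carry the product topology (with $\{*,0,\dots,N\}$ discrete), let $\sigma$ be the left shift, let $[0]$ be the sequence whose entry at $m\ge 0$ is $a_m$ and at $m<0$ is $*$, and let $[i]=\sigma^i([0])$ for $i\ge 0$. The alphabet $\mathcal A=\mathcal A_{\mathbf a}$ is the closure of $\{[i]: i\ge 0\}$. Define $\varrho_{\mathbf a}$ by $\varrho_{\mathbf a}([0])=[0]^{a_0}[1]$, $\varrho_{\mathbf a}([i])=[0]^{a_i}[i-1][i+1]$ for $i>0$, and $\varrho_{\mathbf a}(b)=[0]^{b_0}\,\sigma^{-1}(b)\,\sigma(b)$ for the other letters $b=(b_m)_{m\in\mathbb Z}\in\mathcal A$ (words of letters, $[0]^n$ being $n$ copies of the letter $[0]$). A substitution on a compact Hausdorff space $\mathcal A$ is a continuous map $\varrho:\mathcal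 A\to\mathcal A^+=\bigsqcup_{n\ge1}\mathcal A^n$; it extends to words by concatenation. Its language is the closure in $\bigsqcup_{n\ge 0}\mathcal A^n$ of the set of all subwords of the words $\varrho^k(b)$, $k\ge0$, $b\in\mathcal A$, and its subshift $X_\varrho\subseteq\mathcal A^{\mathbb Z}$ consists of the bi-infinite words all of whose finite subwords are in the language. A natural length function of $\varrho$ with inflation factor $\lambda$ is a continuous function $\ell:\mathcal A\to(0,\infty)$ such that $\lambda\,\ell(b)=\ell(c_1)+\dots+\ell(c_n)$ whenever $\varrho(b)=c_1\cdots c_n$. **Theorem.** For every real $\lambda>2$ there are a sequence $\mathbf a$ of non-negative integers with (A1)–(A3) and a number $\mu\in(0,1)$ with $\frac1\mu=\sum_{i\ge0}a_i\mu^i$ and $\lambda=\mu+\frac1\mu$ such that the following holds. The alphabet $\mathcal A_{\mathbf a}$ is infinite, compact and Hausdorff, $\varrho_{\mathbf a}$ is a well-defined substitution on it, and its subshift is non-empty. There is a natural length function $\ell$ of $\varrho_{\mathbf a}$ with inflation factor $\lambda$; every natural length function of $\varrho_{\mathbf a}$ has inflation factor $\lambda$ and is a positive multiple of $\ell$. For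 every $x\in X_{\varrho_{\mathbf a}}$, if the letters $x_n$ are realized as consecutive intervals of lengths $\ell(x_n)$ that tile $\mathbb R$ in the order of $x$, the tile of $x_0$ being placed anywhere, then the left endpoints of the tiles form a Delone set in $\mathbb R$, i.e. a uniformly discrete and relatively dense set. -/

import Mathlib

open Set Filter Topology

noncomputable section

namespace InfSubst

/-! ### Substitutions over a topological alphabet

Finite words over an alphabet `A` are lists. Mathlib's topology on `List A` is the disjoint union
topology of the product topologies on the sets `A ^ n` of words of length `n`. -/

section General

variable {A : Type*} [TopologicalSpace A]

/-- A substitution: a continuous map from letters to non-empty finite words. -/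
structure IsSubstitution (ϱ : A → List A) : Prop where
  continuous : Continuous ϱ
  ne_nil : ∀ a, ϱ a ≠ []

/-- The level-`k` supertile `ϱ ^ k (a)`, where `ϱ` acts on words by concatenation. -/
def supertile (ϱ : A → List A) (k : ℕ) (a : A) : List A :=
  (fun w : List A => w.flatMap ϱ)^[k] [a]

/-- The language of `ϱ`: the closure of the set of all subwords of supertiles. -/
def language (ϱ : A → List A) : Set (List A) :=
  closure {u | ∃ (k : ℕ) (a : A), u <:+: supertile ϱ k a}

/-- The subword `x_m x_{m+1} ⋯ x_{m+n-1}` of a bi-infinite word. -/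
def window (x : ℤ → A) (m : ℤ) (n : ℕ) : List A :=
  List.ofFn fun i : Fin n => x (m + (i : ℕ))

/-- The subshift of `ϱ`: the bi-infinite words all of whose finite subwords are in the language. -/
def subshift (ϱ : A → List A) : Set (ℤ → A) :=
  {x | ∀ (m : ℤ) (n : ℕ), window x m n ∈ language ϱ}

/-- `ℓ` is a natural (tile) length function for `ϱ`, with inflation factor `lam`: it is continuous
and strictly positive, and a tile of length `ℓ a`, inflated by the factor `lam`, has exactly the
total length of the tiles of the word `ϱ a`, into which it is then cut. -/
structure IsNaturalLength (ϱ : A → List A) (lam : ℝ) (ℓ : A → ℝ) : Prop where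
  continuous : Continuous ℓ
  pos : ∀ a, 0 < ℓ a
  inflate : ∀ a, lam * ℓ a = ((ϱ a).map ℓ).sum

/-- `lam` and `ℓ` form the inflation rule associated with `ϱ`: `ℓ` is a natural length function with
inflation factor `lam`, and it is the only one up to scaling. -/
def IsInflationRule (ϱ : A → List A) (lam : ℝ) (ℓ : A → ℝ) : Prop :=
  IsNaturalLength ϱ lam ℓ ∧
    ∀ (lam' : ℝ) (ℓ' : A → ℝ), IsNaturalLength ϱ lam' ℓ' →
      lam' = lam ∧ ∃ c : ℝ, 0 < c ∧ ∀ a, ℓ' a = c * ℓ a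

end General

/-! ### The point sets of bi-infinite words -/

/-- The left endpoint of the tile of `x n` in the tiling of `ℝ` in which, for every `n`, the letter
`x n` is realized by a tile of length `ℓ (x n)` that is directly followed by the tile of `x (n+1)`,
and in which the tile of `x 0` has left endpoint `0`. -/
def leftEndpoint {A : Type*} (ℓ : A → ℝ) (x : ℤ → A) : ℤ → ℝ
  | Int.ofNat n => ∑ i ∈ Finset.range n, ℓ (x (i : ℤ))
  | Int.negSucc n => -∑ i ∈ Finset.range (n + 1), ℓ (x (-(i : ℤ) - 1))

theorem leftEndpoint_zero {A : Type*} (ℓ : A → ℝ) (x : ℤ → A) : leftEndpoint ℓ x 0 = 0 := by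
  change (∑ i ∈ Finset.range 0, ℓ (x (i : ℤ))) = 0
  simp

theorem leftEndpoint_add_one {A : Type*} (ℓ : A → ℝ) (x : ℤ → A) (n : ℤ) :
    leftEndpoint ℓ x (n + 1) = leftEndpoint ℓ x n + ℓ (x n) := by
  rcases n with n | n
  · change (∑ i ∈ Finset.range (n + 1), ℓ (x (i : ℤ))) = _
    rw [Finset.sum_range_succ]
    rfl
  · rcases n with _ | n
    · have h : Int.negSucc 0 + 1 = 0 := rfl
      rw [h, leftEndpoint_zero]
      simp [leftEndpoint]
    · have h : Int.negSucc (n + 1) + 1 = Int.negSucc n := by omega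
      rw [h]
      simp only [leftEndpoint]
      rw [Finset.sum_range_succ _ (n + 1)]
      have h2 : (-((n + 1 : ℕ) : ℤ) - 1) = Int.negSucc (n + 1) := by omega
      rw [h2]
      ring

/-- The left endpoints of the tiles of `x`, if the left endpoint of the tile of `x 0` is at `t`. -/
def tilePoints {A : Type*} (ℓ : A → ℝ) (x : ℤ → A) (t : ℝ) : Set ℝ :=
  range fun n : ℤ => t + leftEndpoint ℓ x n

/-! ### The substitution of a sequence -/

/-- The symbols `*, 0, 1, 2, …`, with the discrete topology. -/
inductive Symb : Type
  | star : Symb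
  | num (n : ℕ) : Symb

instance : TopologicalSpace Symb := ⊥

instance : DiscreteTopology Symb := ⟨rfl⟩

/-- The value of a symbol (with `0` for `*`; the entry at the origin of a letter is never `*`). -/
def Symb.val : Symb → ℕ
  | star => 0
  | num n => n

/-- The image `σ ^ i (𝟎)` of `[i]` in the bi-infinite sequences of symbols: the entry at position
`m` is `a_{m+i}` if `m + i ≥ 0`, and `*` otherwise. -/
def iota (a : ℕ → ℕ) (i : ℕ) : ℤ → Symb :=
  fun m => if 0 ≤ m + i then Symb.num (a (m + i).toNat) else Symb.star

/-- The alphabet: the closure of the set of all `iota a i` for the product topology. If `a ≤ N`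
then it lies in the closed subspace `{*, 0, …, N} ^ ℤ`, so that it is also the closure there. -/
def Alphabet (a : ℕ → ℕ) : Set (ℤ → Symb) := closure (range (iota a))

/-- The letter `[i]`. -/
def letter (a : ℕ → ℕ) (i : ℕ) : Alphabet a := ⟨iota a i, subset_closure ⟨i, rfl⟩⟩

theorem iota_shift (a : ℕ → ℕ) (i : ℕ) : (fun m => iota a i (m + 1)) = iota a (i + 1) := by
  funext m
  have h : m + 1 + (i : ℤ) = m + ((i + 1 : ℕ) : ℤ) := by push_cast; ring
  simp only [iota, h]

theorem iota_unshift (a : ℕ → ℕ) (i : ℕ) : (fun m => iota a (i + 1) (m - 1)) = iota a i := by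
  rw [← iota_shift]
  funext m
  simp

theorem shift_mem (a : ℕ → ℕ) {b : ℤ → Symb} (hb : b ∈ Alphabet a) :
    (fun m => b (m + 1)) ∈ Alphabet a := by
  have hc : Continuous fun (b : ℤ → Symb) (m : ℤ) => b (m + 1) := by fun_prop
  refine map_mem_closure hc hb ?_
  rintro _ ⟨i, rfl⟩
  exact ⟨i + 1, (iota_shift a i).symm⟩

theorem unshift_mem (a : ℕ → ℕ) {b : ℤ → Symb} (hb : b ∈ Alphabet a) (h0 : b ≠ iota a 0) :
    (fun m => b (m - 1)) ∈ Alphabet a := by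
  have hr : range (iota a) = {iota a 0} ∪ range fun i => iota a (i + 1) := by
    ext s
    constructor
    · rintro ⟨_ | i, rfl⟩
      · exact Or.inl rfl
      · exact Or.inr ⟨i, rfl⟩
    · rintro (rfl | ⟨i, rfl⟩)
      · exact ⟨0, rfl⟩
      · exact ⟨i + 1, rfl⟩
  have hb' : b ∈ closure (range fun i => iota a (i + 1)) := by
    unfold Alphabet at hb
    rw [hr, closure_union, closure_singleton] at hb
    exact hb.resolve_left h0
  have hc : Continuous fun (b : ℤ → Symb) (m : ℤ) => b (m - 1) := by fun_prop
  refine map_mem_closure hc hb' ?_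
  rintro _ ⟨i, rfl⟩
  exact ⟨i, (iota_unshift a i).symm⟩

/-- The letter `σ(b)`. -/
def shiftL (a : ℕ → ℕ) (b : Alphabet a) : Alphabet a := ⟨_, shift_mem a b.2⟩

/-- The letter `σ⁻¹(b)`, for `b ≠ [0]`. -/
def unshiftL (a : ℕ → ℕ) (b : Alphabet a) (h : b.1 ≠ iota a 0) : Alphabet a :=
  ⟨_, unshift_mem a b.2 h⟩

open Classical in
/-- The substitution `ϱ_a`: it sends `[0]` to `[0]^{a_0} [1]`, and every other letter `b` to
`[0]^{b_0} [σ⁻¹(b)] [σ(b)]`. The two theorems below spell this out for the letters `[i]` and for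
the remaining letters. -/
def rho (a : ℕ → ℕ) (b : Alphabet a) : List (Alphabet a) :=
  List.replicate (b.1 0).val (letter a 0) ++
    if h : b.1 = iota a 0 then [shiftL a b] else [unshiftL a b h, shiftL a b]

/-- The substitution on the dense set of letters `[i]`, written on their indices `i`. -/
def preSubst (a : ℕ → ℕ) : ℕ → List ℕ
  | 0 => List.replicate (a 0) 0 ++ [1]
  | i + 1 => List.replicate (a (i + 1)) 0 ++ [i, i + 2]

theorem iota_succ_ne (a : ℕ → ℕ) (i : ℕ) : iota a (i + 1) ≠ iota a 0 := by
  intro h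
  have h1 := congrFun h (-1)
  simp [iota] at h1

theorem shiftL_letter (a : ℕ → ℕ) (i : ℕ) : shiftL a (letter a i) = letter a (i + 1) :=
  Subtype.ext (iota_shift a i)

theorem rho_letter (a : ℕ → ℕ) (i : ℕ) : rho a (letter a i) = (preSubst a i).map (letter a) := by
  have hv : ((letter a i).1 0).val = a i := by simp [letter, iota, Symb.val]
  rcases i with _ | i
  · have h : (letter a 0).1 = iota a 0 := rfl
    rw [rho, dif_pos h, hv, shiftL_letter]
    simp [preSubst]
  · have h : (letter a (i + 1)).1 ≠ iota a 0 := iota_succ_ne a i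
    have hu : unshiftL a (letter a (i + 1)) h = letter a i := Subtype.ext (iota_unshift a i)
    rw [rho, dif_neg h, hv, shiftL_letter, hu]
    simp [preSubst]

theorem rho_limit (a : ℕ → ℕ) (b : Alphabet a) (hb : b.1 ∉ range (iota a)) :
    rho a b = List.replicate (b.1 0).val (letter a 0) ++
      [unshiftL a b (fun h => hb ⟨0, h.symm⟩), shiftL a b] := by
  rw [rho, dif_neg]

end InfSubst

end

noncomputable section

namespace InfSubst

/-! Write λ = μ + 1/μ with 0 < μ < 1. The digits of `a` come from an expansion of 1/μ in powers of
μ; a forced digit at every multiple of some K bounds the runs of zeros (`exists_digits`).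

A natural length with ℓ([0]) = 1 must solve λ ℓ(b) = b₀ + ℓ(σ⁻¹b) + ℓ(σb), with the term ℓ(σ⁻¹b)
absent for b = [0]. The kernel μ^|m| is, up to the factor 1/μ - μ, the Green's function of this
recursion (`pow_natAbs_add`), so ℓ(b) is a weighted sum of the entries of b. Giving `*` the weight μ
- 1 makes the formal length of σ⁻¹([0]) vanish, precisely because Σ aᵢ μ^i = 1/μ. The stars then act
as mirror images of the digits (`hasSum_total_translate`): on the letters [i] all terms are
nonnegative, and bounded gaps give a lower bound uniform in i (`le_total_letter`), which passes to
the closure.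

Uniqueness: a maximum principle on the compact alphabet fixes the factor
(`IsNaturalLength.factor_le`), and the recursion fixes ℓ on the dense letters [i] up to scale. Since
λ > 1 and ℓ is bounded, supertiles contain arbitrarily many letters, so compactness yields
bi-infinite words. Tile lengths bounded above and away from 0 give the Delone property. -/

/-! ### Digit expansions with bounded gaps -/

/-- The remainders of the greedy expansion of `r` in powers of `μ`. -/
def greedyRem (μ r : ℝ) : ℕ → ℝ
  | 0 => r
  | i + 1 => (greedyRem μ r i - ⌊greedyRem μ r i⌋₊) / μ

theorem greedyRem_nonneg {μ r : ℝ} (hμ : 0 < μ) (hr : 0 ≤ r) (i : ℕ) : 0 ≤ greedyRem μ r i := by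
  induction i with
  | zero => exact hr
  | succ i ih => exact div_nonneg (sub_nonneg.2 (Nat.floor_le ih)) hμ.le

theorem greedyRem_le {μ r : ℝ} (hμ : 0 < μ) (i : ℕ) :
    greedyRem μ r i ≤ max r (1 / μ) := by
  cases i with
  | zero => exact le_max_left _ _
  | succ i =>
    refine le_max_of_le_right ?_
    have h := Nat.lt_floor_add_one (greedyRem μ r i)
    simp only [greedyRem]
    gcongr
    linarith

theorem sum_greedy {μ r : ℝ} (hμ : 0 < μ) (n : ℕ) :
    ∑ i ∈ Finset.range n, (⌊greedyRem μ r i⌋₊ : ℝ) * μ ^ i = r - μ ^ n * greedyRem μ r n := by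
  induction n with
  | zero => simp [greedyRem]
  | succ n ih =>
    rw [Finset.sum_range_succ, ih]
    simp only [greedyRem]
    field_simp
    ring

/-- The remainders stay bounded, so the error μ^n times the n-th remainder tends to 0. -/
theorem hasSum_greedy {μ r : ℝ} (hμ : 0 < μ) (hμ1 : μ < 1) (hr : 0 ≤ r) :
    HasSum (fun i : ℕ => (⌊greedyRem μ r i⌋₊ : ℝ) * μ ^ i) r := by
  rw [hasSum_iff_tendsto_nat_of_nonneg (fun i => by positivity)]
  simp_rw [sum_greedy hμ]
  have h : Tendsto (fun n => μ ^ n * greedyRem μ r n) atTop (𝓝 0) := by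
    refine squeeze_zero (fun n => mul_nonneg (by positivity) (greedyRem_nonneg hμ hr n))
      (fun n => mul_le_mul_of_nonneg_left (greedyRem_le hμ n) (by positivity)) ?_
    simpa using (tendsto_pow_atTop_nhds_zero_of_lt_one hμ.le hμ1).mul_const (max r (1 / μ))
  simpa using tendsto_const_nhds.sub h

theorem hasSum_multiples {μ : ℝ} (hμ : 0 < μ) (hμ1 : μ < 1) {K : ℕ} (hK : 0 < K) :
    HasSum (fun i : ℕ => ((if K ∣ i then 1 else 0 : ℕ) : ℝ) * μ ^ i) (1 - μ ^ K)⁻¹ := by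
  have h := hasSum_geometric_of_lt_one (pow_nonneg hμ.le K) (pow_lt_one₀ hμ.le hμ1 hK.ne')
  have hi : Function.Injective fun n : ℕ => K * n := fun m n h => Nat.eq_of_mul_eq_mul_left hK h
  rw [← hi.hasSum_iff]
  · simpa [Function.comp_def, pow_mul] using h
  · intro x hx
    have : ¬ K ∣ x := fun ⟨c, hc⟩ => hx ⟨c, hc.symm⟩
    simp [this]

/-- Every number `1 / μ > 1` has a bounded digit expansion in powers of `μ` in which the runs of
zeros are bounded. -/
theorem exists_digits {μ : ℝ} (hμ : 0 < μ) (hμ1 : μ < 1) :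
    ∃ (a : ℕ → ℕ) (N K : ℕ), (∀ i, a i ≤ N) ∧ a 0 ≠ 0 ∧ (∀ i, ∃ j < K, a (i + j) ≠ 0) ∧
      HasSum (fun i : ℕ => (a i : ℝ) * μ ^ i) (1 / μ) := by
  -- Ones at the multiples of K contribute 1/(1 - μ^K); with μ^K < 1 - μ this stays below 1/μ,
  -- leaving r ≥ 0 for the greedy digits.
  obtain ⟨K, hK⟩ := exists_pow_lt_of_lt_one (sub_pos.2 hμ1) hμ1
  have hK0 : 0 < K := by
    rcases Nat.eq_zero_or_pos K with rfl | h
    · rw [pow_zero] at hK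
      linarith
    · exact h
  set r : ℝ := 1 / μ - (1 - μ ^ K)⁻¹ with hr
  have hr0 : 0 ≤ r := by
    rw [hr, sub_nonneg, one_div]
    exact inv_anti₀ hμ (by linarith)
  refine ⟨fun i => (if K ∣ i then 1 else 0) + ⌊greedyRem μ r i⌋₊, 1 + ⌊max r (1 / μ)⌋₊, K,
    fun i => ?_, by simp, fun i => ?_, ?_⟩
  · refine add_le_add ?_ (Nat.floor_mono (greedyRem_le hμ i))
    split_ifs <;> simp
  -- The distance from i to the next multiple of K; the outer remainder gives 0 if K divides i.
  · refine ⟨(K - i % K) % K, Nat.mod_lt _ hK0, ?_⟩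
    have hd : K ∣ i + (K - i % K) % K := by
      apply Nat.dvd_of_mod_eq_zero
      rw [Nat.add_mod_mod, ← Nat.mod_add_mod, Nat.add_sub_cancel' (Nat.mod_lt _ hK0).le,
        Nat.mod_self]
    simp [hd]
  · have h := (hasSum_multiples hμ hμ1 hK0).add (hasSum_greedy hμ hμ1 hr0)
    rw [hr, add_sub_cancel] at h
    simpa only [Nat.cast_add, add_mul] using h

section General

variable {A : Type*} [TopologicalSpace A]

/-! ### Natural length functions -/

theorem IsNaturalLength.sum_flatMap {ϱ : A → List A} {lam : ℝ} {ℓ : A → ℝ}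
    (h : IsNaturalLength ϱ lam ℓ) (w : List A) :
    ((w.flatMap ϱ).map ℓ).sum = lam * (w.map ℓ).sum := by
  induction w with
  | nil => simp
  | cons a w ih => simp [ih, mul_add, h.inflate a]

theorem IsNaturalLength.sum_supertile {ϱ : A → List A} {lam : ℝ} {ℓ : A → ℝ}
    (h : IsNaturalLength ϱ lam ℓ) (k : ℕ) (a : A) :
    ((supertile ϱ k a).map ℓ).sum = lam ^ k * ℓ a := by
  induction k with
  | zero => simp [supertile]
  | succ k ih =>
    have hs : supertile ϱ (k + 1) a = (supertile ϱ k a).flatMap ϱ :=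
      Function.iterate_succ_apply' _ _ _
    rw [hs, h.sum_flatMap, ih]
    ring

theorem IsNaturalLength.exists_bounds [CompactSpace A] [Nonempty A] {ϱ : A → List A} {lam : ℝ}
    {ℓ : A → ℝ} (h : IsNaturalLength ϱ lam ℓ) :
    ∃ m M : ℝ, 0 < m ∧ ∀ a, m ≤ ℓ a ∧ ℓ a ≤ M := by
  obtain ⟨a, -, ha⟩ := isCompact_univ.exists_isMinOn univ_nonempty h.continuous.continuousOn
  obtain ⟨b, -, hb⟩ := isCompact_univ.exists_isMaxOn univ_nonempty h.continuous.continuousOn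
  exact ⟨ℓ a, ℓ b, h.pos a, fun c => ⟨ha (mem_univ c), hb (mem_univ c)⟩⟩

theorem IsNaturalLength.exists_length_supertile [CompactSpace A] [Nonempty A] {ϱ : A → List A}
    {lam : ℝ} {ℓ : A → ℝ} (h : IsNaturalLength ϱ lam ℓ) (hlam : 1 < lam) (a : A) (n : ℕ) :
    ∃ k, n ≤ (supertile ϱ k a).length := by
  obtain ⟨m, M, hm, hM⟩ := h.exists_bounds
  have hM0 : 0 < M := (h.pos a).trans_le (hM a).2
  obtain ⟨k, hk⟩ := pow_unbounded_of_one_lt (n * M / ℓ a) hlam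
  refine ⟨k, ?_⟩
  have h1 : ((supertile ϱ k a).map ℓ).sum ≤ (supertile ϱ k a).length * M := by
    have := List.sum_le_card_nsmul ((supertile ϱ k a).map ℓ) M (by
      intro x hx
      obtain ⟨c, -, rfl⟩ := List.mem_map.1 hx
      exact (hM c).2)
    simpa using this
  rw [h.sum_supertile] at h1
  rw [div_lt_iff₀ (h.pos a)] at hk
  have h2 : (n : ℝ) < (supertile ϱ k a).length := lt_of_mul_lt_mul_right (hk.trans_le h1) hM0.le
  exact_mod_cast h2.le

/-- Maximum principle: compare the two inflation equations at a letter where ℓ'/ℓ is maximal. -/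
theorem IsNaturalLength.factor_le [CompactSpace A] [Nonempty A] {ϱ : A → List A}
    {lam lam' : ℝ} {ℓ ℓ' : A → ℝ} (h : IsNaturalLength ϱ lam ℓ) (h' : IsNaturalLength ϱ lam' ℓ') :
    lam' ≤ lam := by
  have hc : Continuous fun a => ℓ' a / ℓ a :=
    h'.continuous.div h.continuous fun a => (h.pos a).ne'
  obtain ⟨b, -, hb⟩ := isCompact_univ.exists_isMaxOn univ_nonempty hc.continuousOn
  have hle : ∀ c, ℓ' c ≤ ℓ' b / ℓ b * ℓ c := fun c =>
    (div_le_iff₀ (h.pos c)).1 (hb (mem_univ c))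
  have h1 : ((ϱ b).map ℓ').sum ≤ ((ϱ b).map fun c => ℓ' b / ℓ b * ℓ c).sum :=
    List.sum_le_sum fun c _ => hle c
  rw [List.sum_map_mul_left, ← h.inflate, ← h'.inflate] at h1
  have h2 : ℓ' b / ℓ b * (lam * ℓ b) = lam * ℓ' b := by
    have := (h.pos b).ne'
    field_simp
  rw [h2] at h1
  exact le_of_mul_le_mul_right h1 (h'.pos b)

/-! ### Existence of bi-infinite words -/

theorem continuous_window (m : ℤ) (n : ℕ) : Continuous fun x : ℤ → A => window x m n := by
  induction n generalizing m with
  | zero => simpa [window] using continuous_const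
  | succ n ih =>
    have h : (fun x : ℤ → A => window x m (n + 1)) = fun x => x m :: window x (m + 1) n := by
      funext x
      simp only [window, List.ofFn_succ, Fin.val_zero, Nat.cast_zero, add_zero, Fin.val_succ,
        Nat.cast_add, Nat.cast_one]
      congr 3
      funext i
      ring_nf
    rw [h]
    exact List.continuous_cons.comp ((continuous_apply m).prodMk (ih (m + 1)))

/-- The words that are legal on [-n, n) form decreasing closed sets in a compact space, each
nonempty by centring a long supertile. -/
theorem subshift_nonempty [CompactSpace A] {ϱ : A → List A} (a : A)
    (h : ∀ n : ℕ, ∃ k, n ≤ (supertile ϱ k a).length) : (subshift ϱ).Nonempty := by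
  let E : ℕ → Set (ℤ → A) := fun n =>
    {x | ∀ (m : ℤ) (k : ℕ), -(n : ℤ) ≤ m → m + k ≤ n → window x m k ∈ language ϱ}
  have hcl : ∀ n, IsClosed (E n) := by
    intro n
    simp only [E, ofPred_forall]
    refine isClosed_iInter fun m => isClosed_iInter fun k => isClosed_iInter fun _ =>
      isClosed_iInter fun _ => isClosed_closure.preimage (continuous_window m k)
  have hne : ∀ n, (E n).Nonempty := by
    intro n
    obtain ⟨K, hK⟩ := h (2 * n)
    -- The default letter and the truncation by `toNat` play no role for windows inside [-n, n).
    refine ⟨fun i => (supertile ϱ K a).getD (i + n).toNat a, fun m k hm hk => ?_⟩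
    refine subset_closure ⟨K, a, ?_⟩
    have hw : window (fun i : ℤ => (supertile ϱ K a).getD (i + n).toNat a) m k =
        ((supertile ϱ K a).drop (m + n).toNat).take k := by
      apply List.ext_getElem
      · simp [window]
        omega
      · intro i h1 h2
        simp only [window, List.length_ofFn] at h1
        have h3 : (m + i + n).toNat = (m + n).toNat + i := by omega
        have h4 : (m + n).toNat + i < (supertile ϱ K a).length := by omega
        simp [window, h3, h4]
    rw [hw]
    exact (List.take_prefix _ _).isInfix.trans (List.drop_suffix _ _).isInfix
  obtain ⟨x, hx⟩ := IsCompact.nonempty_iInter_of_sequence_nonempty_isCompact_isClosed E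
    (fun n x hx m k hm hk => hx m k (by push_cast; omega) (by push_cast; omega)) hne
    (hcl 0).isCompact hcl
  refine ⟨x, fun m k => ?_⟩
  exact mem_iInter.1 hx (m.natAbs + k) m k (by omega) (by omega)

end General

/-! ### Tilings with tile lengths bounded above and below -/

section Delone

variable {A : Type*} {ℓ : A → ℝ} {m M : ℝ}

theorem leftEndpoint_add_nat (h : ∀ a, m ≤ ℓ a ∧ ℓ a ≤ M) (x : ℤ → A) (n : ℤ) (k : ℕ) :
    leftEndpoint ℓ x n + k * m ≤ leftEndpoint ℓ x (n + k) := by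
  induction k with
  | zero => simp
  | succ k ih =>
    have := (h (x (n + k))).1
    rw [Nat.cast_succ, Nat.cast_succ, ← add_assoc, leftEndpoint_add_one]
    linarith

theorem exists_leftEndpoint_le (hm : 0 < m) (h : ∀ a, m ≤ ℓ a ∧ ℓ a ≤ M) (x : ℤ → A) (y : ℝ) :
    ∃ n, leftEndpoint ℓ x n ≤ y ∧ y < leftEndpoint ℓ x (n + 1) := by
  obtain ⟨k, hk⟩ := exists_nat_gt (|y| / m)
  rw [div_lt_iff₀ hm] at hk
  have hlow : leftEndpoint ℓ x (-k) ≤ y := by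
    have := leftEndpoint_add_nat h x (-k) k
    rw [neg_add_cancel, leftEndpoint_zero] at this
    linarith [neg_abs_le y]
  have hup : ∀ z : ℤ, leftEndpoint ℓ x z ≤ y → z ≤ k := by
    intro z hz
    by_contra! hlt
    have h1 := leftEndpoint_add_nat h x 0 z.toNat
    have h2 : (z.toNat : ℤ) = z := Int.toNat_of_nonneg (by omega)
    rw [leftEndpoint_zero, zero_add, zero_add, h2] at h1
    have h3 : (k : ℝ) ≤ z.toNat := by
      have : k ≤ z.toNat := by omega
      exact_mod_cast this
    have := mul_le_mul_of_nonneg_right h3 hm.le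
    linarith [le_abs_self y]
  obtain ⟨n, hn, hmax⟩ := Int.exists_greatest_of_bdd ⟨k, hup⟩ ⟨-k, hlow⟩
  refine ⟨n, hn, ?_⟩
  by_contra! hle
  have := hmax _ hle
  omega

theorem exists_deloneSet (hm : 0 < m) (h : ∀ a, m ≤ ℓ a ∧ ℓ a ≤ M) (x : ℤ → A) (t : ℝ) :
    ∃ D : Delone.DeloneSet ℝ, D.carrier = tilePoints ℓ x t := by
  have hM : 0 < M := hm.trans_le ((h (x 0)).1.trans (h (x 0)).2)
  have hlt : ∀ i j : ℤ, i < j → m ≤ leftEndpoint ℓ x j - leftEndpoint ℓ x i := by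
    intro i j hij
    have h1 := leftEndpoint_add_nat h x i (j - i).toNat
    have h2 : i + ((j - i).toNat : ℤ) = j := by omega
    rw [h2] at h1
    have h3 : (1 : ℝ) ≤ (j - i).toNat := by
      have : 1 ≤ (j - i).toNat := by omega
      exact_mod_cast this
    nlinarith
  -- Separation is a strict inequality, so m itself need not work; m / 2 does.
  refine ⟨⟨tilePoints ℓ x t, (m / 2).toNNReal, by simpa using hm, ?_, M.toNNReal, by simpa using hM,
    ?_⟩, rfl⟩
  · rintro _ ⟨i, rfl⟩ _ ⟨j, rfl⟩ hne
    have hij : i ≠ j := fun e => hne (by rw [e])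
    have hd : m ≤ |leftEndpoint ℓ x i - leftEndpoint ℓ x j| := by
      rcases lt_or_gt_of_ne hij with hij | hij
      · rw [abs_sub_comm]
        exact (hlt _ _ hij).trans (le_abs_self _)
      · exact (hlt _ _ hij).trans (le_abs_self _)
    rw [edist_dist, Real.dist_eq]
    simp only [add_sub_add_left_eq_sub]
    change ENNReal.ofReal (m / 2) < _
    exact (ENNReal.ofReal_lt_ofReal_iff (by linarith)).2 (by linarith)
  · intro y _
    obtain ⟨n, hn, hn'⟩ := exists_leftEndpoint_le hm h x (y - t)
    refine ⟨_, ⟨n, rfl⟩, ?_⟩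
    rw [leftEndpoint_add_one] at hn'
    have := (h (x n)).2
    change edist y (t + leftEndpoint ℓ x n) ≤ ENNReal.ofReal M
    rw [edist_dist, Real.dist_eq]
    refine ENNReal.ofReal_le_ofReal ?_
    rw [abs_of_nonneg] <;> linarith

end Delone

variable {a : ℕ → ℕ}

/-! ### The alphabet and the substitution -/

theorem denseRange_letter (a : ℕ → ℕ) : DenseRange (letter a) := by
  intro b
  rw [closure_subtype]
  have h : Subtype.val '' range (letter a) = range (iota a) := by
    rw [← range_comp]
    rfl
  rw [h]
  exact b.2

theorem letter_injective (a : ℕ → ℕ) : Function.Injective (letter a) := by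
  have key : ∀ i j, i < j → letter a i ≠ letter a j := by
    intro i j hij h
    have h1 := congrFun (congrArg Subtype.val h) (-(j : ℤ))
    simp [letter, iota, hij.not_ge] at h1
  intro i j h
  by_contra hne
  rcases lt_or_gt_of_ne hne with hij | hij
  · exact key i j hij h
  · exact key j i hij h.symm

theorem continuous_coord (m : ℤ) : Continuous fun b : Alphabet a => b.1 m :=
  (continuous_apply m).comp continuous_subtype_val

theorem isClosed_coord (m : ℤ) (S : Set Symb) : IsClosed {b : Alphabet a | b.1 m ∈ S} :=
  (isClosed_discrete S).preimage (continuous_coord m)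

theorem entry_le {N : ℕ} (hN : ∀ i, a i ≤ N) (b : Alphabet a) (m : ℤ) : (b.1 m).val ≤ N := by
  refine isClosed_property (denseRange_letter a) (isClosed_coord m {s | s.val ≤ N}) (fun i => ?_) b
  simp only [letter, iota, mem_ofPred_eq]
  split_ifs
  · exact hN _
  · exact Nat.zero_le _

theorem entry_zero_ne_star (b : Alphabet a) : b.1 0 ≠ Symb.star := by
  refine isClosed_property (denseRange_letter a) (isClosed_coord 0 {Symb.star}ᶜ) (fun i => ?_) b
  simp [letter, iota]

/-- All [i] with i ≥ 1 have a digit at -1, a closed condition. Hence [0] is isolated, and the case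
distinction in `rho` is locally constant. -/
theorem eq_iota_zero_iff (b : Alphabet a) : b.1 = iota a 0 ↔ b.1 (-1) = Symb.star := by
  constructor
  · intro h
    simp [h, iota]
  · suffices b.1 (-1) ∈ ({Symb.star}ᶜ : Set Symb) ∨ b = letter a 0 by
      intro h
      rcases this with h' | h'
      · exact absurd h h'
      · exact congrArg Subtype.val h'
    refine isClosed_property (p := fun b : Alphabet a => b.1 (-1) ∈ ({Symb.star}ᶜ : Set Symb) ∨
      b = letter a 0) (denseRange_letter a)
      (by
        rw [ofPred_or]
        exact (isClosed_coord (-1) _).union isClosed_singleton) (fun i => ?_) b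
    rcases i with _ | i
    · exact Or.inr rfl
    · left
      simp [letter, iota]

theorem compactSpace_alphabet {N : ℕ} (hN : ∀ i, a i ≤ N) : CompactSpace (Alphabet a) := by
  let S : Set Symb := insert Symb.star (Symb.num '' Iic N)
  have hS : IsCompact (univ.pi fun _ : ℤ => S) :=
    isCompact_univ_pi fun _ => (((finite_Iic N).image _).insert _).isCompact
  refine isCompact_iff_compactSpace.1 (hS.of_isClosed_subset isClosed_closure ?_)
  intro b hb m _
  have h := entry_le hN ⟨b, hb⟩ m
  change b m ∈ S
  change (b m).val ≤ N at h
  rcases hbm : b m with _ | n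
  · exact mem_insert _ _
  · rw [hbm] at h
    exact mem_insert_of_mem _ ⟨n, h, rfl⟩

open Classical in
/-- The letter `σ⁻¹(b)`, with `σ⁻¹([0])` replaced by `[0]`. -/
def unshiftTotal (a : ℕ → ℕ) (b : Alphabet a) : Alphabet a :=
  if h : b.1 = iota a 0 then b else unshiftL a b h

theorem continuous_shiftL : Continuous (shiftL a) := by
  refine Continuous.subtype_mk ?_ _
  exact continuous_pi fun m => continuous_coord (m + 1)

theorem continuous_unshiftTotal : Continuous (unshiftTotal a) := by
  rw [continuous_induced_rng]
  refine continuous_pi fun m => ?_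
  classical
  -- Each output entry is a function of three entries of b, hence continuous as symbols are
  -- discrete.
  let g : Symb × Symb × Symb → Symb := fun s => if s.1 = Symb.star then s.2.1 else s.2.2
  have hg : (fun b : Alphabet a => (unshiftTotal a b).1 m) =
      fun b => g (b.1 (-1), b.1 m, b.1 (m - 1)) := by
    funext b
    by_cases h : b.1 = iota a 0
    · simp only [unshiftTotal, dif_pos h, g, if_pos ((eq_iota_zero_iff b).1 h)]
    · simp only [unshiftTotal, dif_neg h, g, if_neg (mt (eq_iota_zero_iff b).2 h)]
      rfl
  change Continuous fun b : Alphabet a => (unshiftTotal a b).1 m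
  rw [hg]
  exact (continuous_of_discreteTopology (f := g)).comp
    ((continuous_coord _).prodMk ((continuous_coord _).prodMk (continuous_coord _)))

open Classical in
theorem rho_eq (b : Alphabet a) : rho a b = List.replicate (b.1 0).val (letter a 0) ++
    if b.1 (-1) = Symb.star then [shiftL a b] else [unshiftTotal a b, shiftL a b] := by
  by_cases h : b.1 = iota a 0
  · rw [rho, dif_pos h, if_pos ((eq_iota_zero_iff b).1 h)]
  · rw [rho, dif_neg h, if_neg (mt (eq_iota_zero_iff b).2 h), unshiftTotal, dif_neg h]

theorem continuous_append_left {X A : Type*} [TopologicalSpace X] [TopologicalSpace A]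
    (l : List A) {f : X → List A} (hf : Continuous f) : Continuous fun x => l ++ f x := by
  induction l with
  | nil => simpa using hf
  | cons c l ih => exact List.continuous_cons.comp (continuous_const.prodMk ih)

theorem isSubstitution_rho (a : ℕ → ℕ) : IsSubstitution (rho a) := by
  classical
  constructor
  · rw [continuous_iff_continuousAt]
    intro b
    have hcoord : ∀ m : ℤ, ∀ᶠ c : Alphabet a in 𝓝 b, c.1 m = b.1 m := fun m =>
      (continuous_coord m).continuousAt.eventually_mem
        ((isOpen_discrete {b.1 m}).mem_nhds rfl)
    -- Near b the entries at 0 and -1 are constant, so the shape of the image word is fixed.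
    have hev : (fun c : Alphabet a => List.replicate (b.1 0).val (letter a 0) ++
        if b.1 (-1) = Symb.star then [shiftL a c] else [unshiftTotal a c, shiftL a c])
        =ᶠ[𝓝 b] rho a := by
      filter_upwards [hcoord 0, hcoord (-1)] with c h0 h1
      rw [rho_eq, h0, h1]
    refine ContinuousAt.congr (Continuous.continuousAt ?_) hev
    apply continuous_append_left
    have h1 : Continuous fun c : Alphabet a => [shiftL a c] :=
      List.continuous_cons.comp (continuous_shiftL.prodMk continuous_const)
    split_ifs
    · exact h1
    · exact List.continuous_cons.comp (continuous_unshiftTotal.prodMk h1)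
  · intro b h
    rw [rho_eq] at h
    split_ifs at h <;> simp at h

/-! ### Uniqueness of length functions up to scaling -/

/-- Two solutions of the recursion for the lengths of the letters are proportional. -/
theorem IsNaturalLength.eq_mul {lam : ℝ} {ℓ ℓ' : Alphabet a → ℝ}
    (h : IsNaturalLength (rho a) lam ℓ) (h' : IsNaturalLength (rho a) lam ℓ') (b : Alphabet a) :
    ℓ' b = ℓ' (letter a 0) / ℓ (letter a 0) * ℓ b := by
  set c := ℓ' (letter a 0) / ℓ (letter a 0) with hc
  have h0 : ℓ' (letter a 0) = c * ℓ (letter a 0) := (div_mul_cancel₀ _ (h.pos _).ne').symm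
  refine isClosed_property (denseRange_letter a)
    (isClosed_eq h'.continuous (h.continuous.const_mul c)) (fun i => ?_) b
  -- Inflating [i] determines the length of [i+1] from those of [0], [i-1] and [i]; hence induction
  -- on consecutive pairs.
  have key : ∀ i, ℓ' (letter a i) = c * ℓ (letter a i) ∧
      ℓ' (letter a (i + 1)) = c * ℓ (letter a (i + 1)) := by
    intro i
    induction i with
    | zero =>
      refine ⟨h0, ?_⟩
      have e := h.inflate (letter a 0)
      have e' := h'.inflate (letter a 0)
      simp only [rho_letter, preSubst, List.map_append, List.map_replicate, List.map_cons,
        List.map_nil, List.sum_append, List.sum_replicate, List.sum_cons, List.sum_nil,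
        nsmul_eq_mul, add_zero, h0] at e e' ⊢
      linear_combination c * e - e'
    | succ i ih =>
      refine ⟨ih.2, ?_⟩
      have e := h.inflate (letter a (i + 1))
      have e' := h'.inflate (letter a (i + 1))
      simp only [rho_letter, preSubst, List.map_append, List.map_replicate, List.map_cons,
        List.map_nil, List.sum_append, List.sum_replicate, List.sum_cons, List.sum_nil,
        nsmul_eq_mul, add_zero, h0, ih.1, ih.2] at e e' ⊢
      linear_combination c * e - e'
  exact (key i).1

variable {μ : ℝ}

/-! ### The natural length function -/

/-- The weight of a symbol. The weight of `*` is chosen so that the length formula below satisfies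
the boundary condition of the recursion for the lengths. -/
def weight (μ : ℝ) : Symb → ℝ
  | Symb.star => μ - 1
  | Symb.num n => n

/-- The weighted sum of the entries of a bi-infinite sequence of symbols. -/
def total (μ : ℝ) (b : ℤ → Symb) : ℝ := ∑' m : ℤ, μ ^ m.natAbs * weight μ (b m)

/-- The length of the letter `b`. -/
def length (μ : ℝ) (b : ℤ → Symb) : ℝ := total μ b / (1 / μ - μ)

theorem summable_pow_natAbs (hμ : 0 < μ) (hμ1 : μ < 1) :
    Summable fun m : ℤ => μ ^ m.natAbs := by
  apply Summable.of_nat_of_neg <;> simpa using summable_geometric_of_lt_one hμ.le hμ1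

theorem abs_weight_le (hμ : 0 < μ) (hμ1 : μ < 1) {N : ℕ} {s : Symb} (hs : s.val ≤ N) :
    |weight μ s| ≤ N + 1 := by
  rcases s with _ | n
  · have : (0 : ℝ) ≤ N := N.cast_nonneg
    rw [weight, abs_le]
    constructor <;> linarith
  · have : (n : ℝ) ≤ N := Nat.cast_le.2 hs
    rw [weight, Nat.abs_cast]
    linarith

theorem norm_term_le (hμ : 0 < μ) (hμ1 : μ < 1) {N : ℕ} {s : Symb} (hs : s.val ≤ N) (m : ℤ) :
    ‖μ ^ m.natAbs * weight μ s‖ ≤ μ ^ m.natAbs * (N + 1) := by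
  rw [norm_mul, Real.norm_of_nonneg (by positivity)]
  exact mul_le_mul_of_nonneg_left (abs_weight_le hμ hμ1 hs) (by positivity)

theorem hasSum_total (hμ : 0 < μ) (hμ1 : μ < 1) {N : ℕ} {b : ℤ → Symb}
    (hb : ∀ m, (b m).val ≤ N) :
    HasSum (fun m : ℤ => μ ^ m.natAbs * weight μ (b m)) (total μ b) :=
  (Summable.of_norm_bounded ((summable_pow_natAbs hμ hμ1).mul_right ((N : ℝ) + 1))
    fun m => norm_term_le hμ hμ1 (hb m) m).hasSum

/-- The kernel μ^|m| solves the homogeneous recursion away from 0; the kink at 0 produces the source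
term. -/
theorem pow_natAbs_add (hμ : μ ≠ 0) (m : ℤ) :
    μ ^ (m - 1).natAbs + μ ^ (m + 1).natAbs =
      (μ + 1 / μ) * μ ^ m.natAbs - if m = 0 then 1 / μ - μ else 0 := by
  rcases lt_trichotomy m 0 with h | rfl | h
  · obtain ⟨k, hk⟩ : ∃ k, (m + 1).natAbs = k := ⟨_, rfl⟩
    have h1 : m.natAbs = k + 1 := by omega
    have h2 : (m - 1).natAbs = k + 2 := by omega
    rw [hk, h1, h2, if_neg h.ne]
    field_simp
    ring
  · simp
    ring
  · obtain ⟨k, hk⟩ : ∃ k, (m - 1).natAbs = k := ⟨_, rfl⟩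
    have h1 : m.natAbs = k + 1 := by omega
    have h2 : (m + 1).natAbs = k + 2 := by omega
    rw [hk, h1, h2, if_neg h.ne']
    field_simp
    ring

/-- The recursion for the lengths of the letters. -/
theorem total_shift_add (hμ : 0 < μ) (hμ1 : μ < 1) {N : ℕ} {b : ℤ → Symb}
    (hb : ∀ m, (b m).val ≤ N) :
    (μ + 1 / μ) * total μ b = (1 / μ - μ) * weight μ (b 0) +
      total μ (fun m => b (m - 1)) + total μ fun m => b (m + 1) := by
  have h1 := hasSum_total hμ hμ1 hb
  have h2 := hasSum_total hμ hμ1 (b := fun m => b (m - 1)) fun m => hb _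
  have h3 := hasSum_total hμ hμ1 (b := fun m => b (m + 1)) fun m => hb _
  -- Reindexing moves both shifts from b onto the kernel.
  rw [← (Equiv.addRight (1 : ℤ)).hasSum_iff] at h2
  rw [← (Equiv.subRight (1 : ℤ)).hasSum_iff] at h3
  have h4 : HasSum (fun m : ℤ => if m = 0 then (1 / μ - μ) * weight μ (b 0) else 0)
      ((1 / μ - μ) * weight μ (b 0)) := hasSum_ite_eq 0 _
  refine (h1.mul_left (μ + 1 / μ)).unique ?_
  refine (congrArg (HasSum · _) (funext fun m => ?_)).mpr ((h4.add h2).add h3)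
  have h := pow_natAbs_add hμ.ne' m
  simp only [Function.comp_apply, Equiv.coe_addRight, Equiv.subRight_apply, add_sub_cancel_right,
    sub_add_cancel]
  split_ifs at h ⊢ with hm
  · rw [← hm]
    linear_combination -weight μ (b m) * h
  · linear_combination -weight μ (b m) * h

/-- The sum of the weights around the position `k - 1` of the sequence `a`, for `k ≥ 0`. -/
theorem hasSum_total_translate (hμ : 0 < μ) (hμ1 : μ < 1) {N : ℕ} (hN : ∀ i, a i ≤ N)
    (hs : HasSum (fun i : ℕ => (a i : ℝ) * μ ^ i) (1 / μ)) (k : ℕ) :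
    HasSum (fun j : ℕ => (a j : ℝ) * (μ ^ ((j : ℤ) + 1 - k).natAbs - μ ^ (j + k + 1)))
      (total μ fun m => iota a 0 (m + (k - 1))) := by
  have hv : ∀ m, (iota a 0 m).val ≤ N := fun m => entry_le hN (letter a 0) m
  have h1 := hasSum_total hμ hμ1 (b := fun m => iota a 0 (m + (k - 1))) fun m => hv _
  rw [← (Equiv.addRight (1 - k : ℤ)).hasSum_iff] at h1
  have hnat : (fun j : ℕ => ((fun m : ℤ => μ ^ m.natAbs * weight μ (iota a 0 (m + (k - 1)))) ∘
      Equiv.addRight (1 - k : ℤ)) (j : ℤ)) = fun j : ℕ => (a j : ℝ) * μ ^ ((j : ℤ) + 1 - k).natAbs := by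
    funext j
    have e : (j : ℤ) + (1 - k) + (k - 1) = j := by ring
    have e' : (j : ℤ) + (1 - k) = j + 1 - k := by ring
    simp only [Function.comp_apply, Equiv.coe_addRight, e]
    simp [iota, weight, e', mul_comm]
  have hneg : HasSum (fun j : ℕ => ((fun m : ℤ => μ ^ m.natAbs *
      weight μ (iota a 0 (m + (k - 1)))) ∘ Equiv.addRight (1 - k : ℤ)) (-(j + 1 : ℤ))) (-μ ^ k) := by
    have hg := (hasSum_geometric_of_lt_one hμ.le hμ1).mul_left (μ ^ k * (μ - 1))
    have hval : μ ^ k * (μ - 1) * (1 - μ)⁻¹ = -μ ^ k := by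
      have : 1 - μ ≠ 0 := by linarith
      field_simp
      ring
    rw [hval] at hg
    refine (congrArg (HasSum · _) (funext fun j => ?_)).mpr (hg)
    have e : -(j + 1 : ℤ) + (1 - k) + (k - 1) = -(j + 1) := by ring
    have e' : (-(j + 1 : ℤ) + (1 - k)).natAbs = k + j := by omega
    simp only [Function.comp_apply, Equiv.coe_addRight, e, e']
    have e2 : iota a 0 (-(j + 1 : ℤ)) = Symb.star := by
      simp only [iota]
      rw [if_neg (by push_cast; omega)]
    rw [e2, weight, pow_add]
    ring
  have hpos : Summable fun j : ℕ => (a j : ℝ) * μ ^ ((j : ℤ) + 1 - k).natAbs := by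
    rw [← hnat]
    exact h1.summable.comp_injective Nat.cast_injective
  obtain ⟨S, hS⟩ := hpos
  have hnat_sum := hS
  rw [← hnat] at hnat_sum
  have h2 := HasSum.of_nat_of_neg_add_one hnat_sum hneg
  have h3 := h1.unique h2
  rw [h3]
  -- The stars contribute -μ^k in total, which is -μ^(k+1) Σ aⱼ μ^j: one mirror charge for each
  -- digit.
  have h4 := (hs.mul_left (μ ^ (k + 1)))
  have hval : μ ^ (k + 1) * (1 / μ) = μ ^ k := by
    rw [pow_succ]
    field_simp
  rw [hval] at h4
  refine (congrArg (HasSum · _) (funext fun j => ?_)).mpr (hS.add h4.neg)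
  ring

theorem length_denom_pos (hμ : 0 < μ) (hμ1 : μ < 1) : 0 < 1 / μ - μ := by
  have : 1 < 1 / μ := (one_lt_div hμ).2 hμ1
  linarith

theorem length_zero (hμ : 0 < μ) (hμ1 : μ < 1) {N : ℕ} (hN : ∀ i, a i ≤ N)
    (hs : HasSum (fun i : ℕ => (a i : ℝ) * μ ^ i) (1 / μ)) : length μ (iota a 0) = 1 := by
  have h := hasSum_total_translate hμ hμ1 hN hs 1
  simp only [Nat.cast_one, sub_self, add_zero, add_sub_cancel_right] at h
  have h2 : total μ (iota a 0) = 1 / μ - μ := by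
    refine h.unique ?_
    have h3 := hs.mul_right (1 - μ ^ 2)
    have hval : 1 / μ * (1 - μ ^ 2) = 1 / μ - μ := by
      field_simp
    rw [hval] at h3
    refine (congrArg (HasSum · _) (funext fun j => ?_)).mpr (h3)
    simp only [Int.natAbs_natCast]
    ring
  rw [length, h2, div_self (length_denom_pos hμ hμ1).ne']

/-- At k = 0 every digit cancels against its mirror image. This boundary value accounts for the
missing σ⁻¹ in the image of [0]. -/
theorem total_unshift_zero (hμ : 0 < μ) (hμ1 : μ < 1) {N : ℕ} (hN : ∀ i, a i ≤ N)
    (hs : HasSum (fun i : ℕ => (a i : ℝ) * μ ^ i) (1 / μ)) :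
    total μ (fun m => iota a 0 (m - 1)) = 0 := by
  have h := hasSum_total_translate hμ hμ1 hN hs 0
  simp only [Nat.cast_zero, zero_sub, ← sub_eq_add_neg, sub_zero, add_zero] at h
  refine h.unique ?_
  refine (congrArg (HasSum · _) (funext fun j => ?_)).mpr (hasSum_zero)
  have : ((j : ℤ) + 1).natAbs = j + 1 := by omega
  simp [this]

/-- A single nonzero digit within distance K of the origin already gives the bound; independence of
i is what survives in the closure. -/
theorem le_total_letter (hμ : 0 < μ) (hμ1 : μ < 1) {N K : ℕ} (hN : ∀ i, a i ≤ N)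
    (hK : ∀ i, ∃ j < K, a (i + j) ≠ 0)
    (hs : HasSum (fun i : ℕ => (a i : ℝ) * μ ^ i) (1 / μ)) (i : ℕ) :
    μ ^ K * (1 - μ ^ 2) ≤ total μ (iota a i) := by
  have h := hasSum_total_translate hμ hμ1 hN hs (i + 1)
  have he : (fun m : ℤ => iota a 0 (m + (((i + 1 : ℕ) : ℤ) - 1))) = iota a i := by
    funext m
    simp [iota]
  rw [he] at h
  have hle : ∀ n : ℕ, μ ^ (n + (i + 1) + 1) ≤ μ ^ ((n : ℤ) + 1 - (i + 1 : ℕ)).natAbs := fun n =>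
    pow_le_pow_of_le_one hμ.le hμ1.le (by omega)
  obtain ⟨j, hj, hj0⟩ := hK i
  refine le_trans ?_ (le_hasSum h (i + j) fun n _ =>
    mul_nonneg (Nat.cast_nonneg _) (sub_nonneg.2 (hle n)))
  have h1 : (1 : ℝ) ≤ a (i + j) := by exact_mod_cast Nat.one_le_iff_ne_zero.2 hj0
  have e1 : (((i + j : ℕ) : ℤ) + 1 - (i + 1 : ℕ)).natAbs = j := by omega
  have h2 : μ ^ j * (1 - μ ^ 2) ≤ μ ^ j - μ ^ (i + j + (i + 1) + 1) := by
    have e2 : μ ^ (i + j + (i + 1) + 1) ≤ μ ^ (j + 2) :=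
      pow_le_pow_of_le_one hμ.le hμ1.le (by omega)
    rw [pow_add μ j 2] at e2
    linarith
  have h3 : 0 ≤ 1 - μ ^ 2 := by nlinarith
  have h4 : μ ^ K ≤ μ ^ j := pow_le_pow_of_le_one hμ.le hμ1.le hj.le
  rw [e1]
  have h5 := mul_le_mul_of_nonneg_right h4 h3
  have h6 : 0 ≤ μ ^ j - μ ^ (i + j + (i + 1) + 1) := by
    have := mul_nonneg (pow_nonneg hμ.le j) h3
    linarith
  have h7 := mul_le_mul_of_nonneg_right h1 h6
  linarith

theorem continuous_length (hμ : 0 < μ) (hμ1 : μ < 1) {N : ℕ} (hN : ∀ i, a i ≤ N) :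
    Continuous fun b : Alphabet a => length μ b.1 := by
  refine Continuous.div_const ?_ _
  refine continuous_tsum (fun m => ?_) ((summable_pow_natAbs hμ hμ1).mul_right ((N : ℝ) + 1))
    fun m b => norm_term_le hμ hμ1 (entry_le hN b m) m
  exact continuous_const.mul ((continuous_of_discreteTopology (f := weight μ)).comp
    (continuous_coord m))

theorem length_pos (hμ : 0 < μ) (hμ1 : μ < 1) {N K : ℕ} (hN : ∀ i, a i ≤ N)
    (hK : ∀ i, ∃ j < K, a (i + j) ≠ 0)
    (hs : HasSum (fun i : ℕ => (a i : ℝ) * μ ^ i) (1 / μ)) (b : Alphabet a) :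
    0 < length μ b.1 := by
  have hd := length_denom_pos hμ hμ1
  have hδ : 0 < μ ^ K * (1 - μ ^ 2) / (1 / μ - μ) :=
    div_pos (mul_pos (pow_pos hμ K) (by nlinarith)) hd
  refine hδ.trans_le (isClosed_property (denseRange_letter a)
    (isClosed_le continuous_const (continuous_length hμ hμ1 hN)) (fun i => ?_) b)
  exact div_le_div_of_nonneg_right (le_total_letter hμ hμ1 hN hK hs i) hd.le

theorem length_inflate (hμ : 0 < μ) (hμ1 : μ < 1) {N : ℕ} (hN : ∀ i, a i ≤ N)
    (hs : HasSum (fun i : ℕ => (a i : ℝ) * μ ^ i) (1 / μ)) (b : Alphabet a) :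
    (μ + 1 / μ) * length μ b.1 = ((rho a b).map fun c => length μ c.1).sum := by
  have hd := (length_denom_pos hμ hμ1).ne'
  have h := total_shift_add hμ hμ1 fun m => entry_le hN b m
  have h0 : length μ (letter a 0).1 = 1 := length_zero hμ hμ1 hN hs
  have hw : weight μ (b.1 0) = (b.1 0).val := by
    have h := entry_zero_ne_star b
    revert h
    rcases b.1 0 with _ | n
    · exact fun h => absurd rfl h
    · exact fun _ => rfl
  have hrec : (μ + 1 / μ) * length μ b.1 = (b.1 0).val +
      (length μ (fun m => b.1 (m - 1)) + length μ fun m => b.1 (m + 1)) := by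
    rw [hw] at h
    simp only [length]
    rw [← add_div, ← mul_div_assoc, h, add_assoc, add_div, mul_div_cancel_left₀ _ hd]
  rw [hrec, rho]
  simp only [List.map_append, List.map_replicate, List.sum_append, List.sum_replicate, h0,
    nsmul_eq_mul, mul_one]
  split_ifs with hb
  · have hz : length μ (fun m => b.1 (m - 1)) = 0 := by
      rw [hb, length, total_unshift_zero hμ hμ1 hN hs, zero_div]
    simp [hz, shiftL]
  · simp [shiftL, unshiftL]

/-! ### The inflation rule and the choice of μ -/

theorem isInflationRule_length (hμ : 0 < μ) (hμ1 : μ < 1) {N K : ℕ} (hN : ∀ i, a i ≤ N)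
    (hK : ∀ i, ∃ j < K, a (i + j) ≠ 0)
    (hs : HasSum (fun i : ℕ => (a i : ℝ) * μ ^ i) (1 / μ)) :
    IsInflationRule (rho a) (μ + 1 / μ) fun b => length μ b.1 := by
  have := compactSpace_alphabet hN
  have : Nonempty (Alphabet a) := ⟨letter a 0⟩
  have h : IsNaturalLength (rho a) (μ + 1 / μ) fun b => length μ b.1 :=
    ⟨continuous_length hμ hμ1 hN, length_pos hμ hμ1 hN hK hs, length_inflate hμ hμ1 hN hs⟩
  refine ⟨h, fun lam' ℓ' h' => ?_⟩
  obtain rfl : lam' = μ + 1 / μ := le_antisymm (h.factor_le h') (h'.factor_le h)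
  exact ⟨rfl, _, div_pos (h'.pos _) (h.pos _), h.eq_mul h'⟩

theorem exists_add_one_div_eq {lam : ℝ} (hlam : 2 < lam) :
    ∃ μ : ℝ, 0 < μ ∧ μ < 1 ∧ lam = μ + 1 / μ := by
  set s := √(lam ^ 2 - 4) with hsdef
  have hs : s ^ 2 = lam ^ 2 - 4 := Real.sq_sqrt (by nlinarith)
  have hs0 : 0 ≤ s := Real.sqrt_nonneg _
  have h1 : s < lam := by nlinarith
  have h2 : lam - 2 < s := by nlinarith
  -- The smaller root of x² - λx + 1.
  refine ⟨(lam - s) / 2, by linarith, by linarith, ?_⟩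
  have : lam - s ≠ 0 := by linarith
  field_simp
  nlinarith

end InfSubst

end

theorem theorem1p1 (lam : ℝ) (hlam : 2 < lam) :
    ∃ (a : ℕ → ℕ) (μ : ℝ),
      -- the sequence `a` is bounded, `a 0 ≠ 0`, and the runs of zeros in `a` are bounded
      (∃ N : ℕ, ∀ i, a i ≤ N) ∧
      a 0 ≠ 0 ∧
      (∃ C : ℕ, 0 < C ∧ ∀ i k : ℕ, (∀ j ≤ k, a (i + j) = 0) → k < C) ∧
      -- the parameter `μ`
      0 < μ ∧ μ < 1 ∧ HasSum (fun i : ℕ => (a i : ℝ) * μ ^ i) (1 / μ) ∧ lam = μ + 1 / μ ∧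
      -- a substitution on an infinite compact Hausdorff alphabet, with a non-empty subshift
      Infinite (InfSubst.Alphabet a) ∧
      CompactSpace (InfSubst.Alphabet a) ∧
      T2Space (InfSubst.Alphabet a) ∧
      InfSubst.IsSubstitution (InfSubst.rho a) ∧
      (InfSubst.subshift (InfSubst.rho a)).Nonempty ∧
      -- the associated inflation rule has factor `lam`, and its tilings give Delone sets
      ∃ ℓ : InfSubst.Alphabet a → ℝ,
        InfSubst.IsInflationRule (InfSubst.rho a) lam ℓ ∧
        ∀ x ∈ InfSubst.subshift (InfSubst.rho a), ∀ t : ℝ,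
          ∃ D : Delone.DeloneSet ℝ, D.carrier = InfSubst.tilePoints ℓ x t := by
  obtain ⟨μ, hμ, hμ1, rfl⟩ := InfSubst.exists_add_one_div_eq hlam
  obtain ⟨a, N, K, hN, ha0, hK, hs⟩ := InfSubst.exists_digits hμ hμ1
  have hcompact := InfSubst.compactSpace_alphabet hN
  have : Nonempty (InfSubst.Alphabet a) := ⟨InfSubst.letter a 0⟩
  have hrule := InfSubst.isInflationRule_length hμ hμ1 hN hK hs
  obtain ⟨m, M, hm, hM⟩ := hrule.1.exists_bounds
  refine ⟨a, μ, ⟨N, hN⟩, ha0, ⟨K, ?_, fun i k hk => ?_⟩, hμ, hμ1, hs, rfl,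
    Infinite.of_injective _ (InfSubst.letter_injective a), hcompact, inferInstance,
    InfSubst.isSubstitution_rho a, ?_, _, hrule, fun x _ t => InfSubst.exists_deloneSet hm hM x t⟩
  · obtain ⟨j, hj, -⟩ := hK 0
    exact Nat.zero_lt_of_lt hj
  · obtain ⟨j, hj, hj0⟩ := hK i
    by_contra! hle
    exact hj0 (hk j (hj.le.trans hle))
  · exact InfSubst.subshift_nonempty (InfSubst.letter a 0)
      (hrule.1.exists_length_supertile (by linarith) (InfSubst.letter a 0))
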